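/- Let $n\ge 1$ and $0\le k\le n$ be integers, $A=\mathbb{R}[x_1,\dots,x_n]$, and let $D$ be the $A$-module of $\mathbb{R}$-linear derivations of $A$. A hyperplane arrangement $\mathcal{A}$ is a finite set of linear hyperplanes $H=\{\alpha_H=0\}$ in $\mathbb{R}^n$, with $\alpha_H$ a nonzero linear form; put $$D(\mathcal{A})=\{\theta\in D:\ \alpha_H\mid\theta(\alpha_H)\ \text{for all } H\in\mathcal{A}\},$$ and call $\mathcal{A}$ free if $D(\mathcal{A})$ is a free $A$-module. The intersection lattice $L(\mathcal{A})$ is the set of all intersections of members of $\mathcal{A}$ (including $\mathbb{R}^n$), ordered by reverse inclusion, with Möbius function $\mu$; the characteristic polynomial is $\chi(\mathcal{A},t)=\sum_{X\in L(\mathcal{A})}\mu(\mathbb{R}^n,X)\,t^{\dim X}$, and the exponents $\exp\mathcal{A}$ are the roots of $\chi(\mathcal{A},t)$ in $\mathbb C$, counted with multiplicity. Let $$\mathcal{D}_n=\{x_i\pm x_j=0: 1\le i<j\le n\},\quad \mathcal{B}_n=\mathcal{D}_n\cup\{x_i=0:1\le i\le n\},\quad \mathcal{DB}_{n,k}=\mathcal{D}_n\cup\{x_i=0:1\le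 i\le k\}.$$ Let $\mathbf{X}^d=\sum_i x_i^d\,\partial/\partial x_i$, $\hat{\mathbf{X}}=\sum_i\bigl(\prod_{j\ne i}x_j\bigr)\partial/\partial x_i$ and $\theta_k=x_1x_2\cdots x_k\,\hat{\mathbf{X}}$. Say that a derivation $\theta$ has degree $d\in\mathbb{Z}$ if it maps the homogeneous polynomials of each degree $i\ge 0$ into those of degree $i+d$ (only $0$ being homogeneous of negative degree). Then: 1. $\mathcal{DB}_{n,0}=\mathcal{D}_n$ and $\mathcal{DB}_{n,n}=\mathcal{B}_n$. 2. $\mathcal{DB}_{n,k}$ is free, and the $n$ derivations $\mathbf{X}^1,\mathbf{X}^3,\dots,\mathbf{X}^{2n-3},\theta_k$ form a basis of the $A$-module $D(\mathcal{DB}_{n,k})$. 3. The polynomial $Q=x_1\cdots x_k\prod_{1\le i<j\le n}(x_i^2-x_j^2)$ is a defining polynomial $\prod_{H\in\mathcal{DB}_{n,k}}\alpha_H$ of $\mathcal{DB}_{n,k}$, and the $n\times n$ matrix $\Theta$ whose $j$-th column consists of the values at $x_1,\dots,x_n$ of the $j$-th derivation in this list satisfies $\det\Theta=(-1)^{(n-1)(n+2)/2}\,Q$.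 4. The derivations in this list have, in order, the degrees $e-1$ for $e=1,3,\dots,2n-3,n-1+k$, and $\exp\mathcal{DB}_{n,k}=\{1,3,5,\dots,2n-3,n-1+k\}$ as a multiset. For $n=1$ the lists $\mathbf{X}^1,\dots,\mathbf{X}^{2n-3}$ and $1,3,\dots,2n-3$ are empty. -/

import Mathlib

noncomputable section

namespace HyperplaneArr

open MvPolynomial

/-- The polynomial algebra `ℝ[x_1, …, x_n]`. -/
abbrev Poly (n : ℕ) : Type := MvPolynomial (Fin n) ℝ

/-- The module of all `ℝ`-linear derivations of `ℝ[x_1, …, x_n]`. -/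
abbrev Der (n : ℕ) : Type := Derivation ℝ (Poly n) (Poly n)

/-- A (central) hyperplane arrangement in `ℝ^n`: a finite set of linear subspaces of
dimension `n - 1`. -/
@[ext]
structure Arrangement (n : ℕ) where
  hyperplanes : Set (Submodule ℝ (Fin n → ℝ))
  finite : hyperplanes.Finite
  dim : ∀ H ∈ hyperplanes, Module.finrank ℝ H + 1 = n

namespace Arrangement

variable {n : ℕ}

/-! ### The intersection lattice, the characteristic polynomial and the exponents -/

/-- The intersection lattice: all intersections of hyperplanes of `A` (the empty intersection
being `ℝ^n`), ordered by reverse inclusion. -/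
def IntersectionLattice (A : Arrangement n) : Type :=
  {X : (Submodule ℝ (Fin n → ℝ))ᵒᵈ //
    ∃ S : Set (Submodule ℝ (Fin n → ℝ)), S ⊆ A.hyperplanes ∧ OrderDual.ofDual X = sInf S}

/-- The reverse inclusion order. -/
instance (A : Arrangement n) : PartialOrder A.IntersectionLattice :=
  inferInstanceAs (PartialOrder {X : (Submodule ℝ (Fin n → ℝ))ᵒᵈ //
    ∃ S : Set (Submodule ℝ (Fin n → ℝ)), S ⊆ A.hyperplanes ∧ OrderDual.ofDual X = sInf S})

/-- The subspace of `ℝ^n` underlying an element of the intersection lattice. -/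
def IntersectionLattice.space {A : Arrangement n} (X : A.IntersectionLattice) :
    Submodule ℝ (Fin n → ℝ) :=
  OrderDual.ofDual X.1

theorem IntersectionLattice.le_iff {A : Arrangement n} (X Y : A.IntersectionLattice) :
    X ≤ Y ↔ Y.space ≤ X.space :=
  Iff.rfl

instance (A : Arrangement n) : Finite A.IntersectionLattice := by
  have h : {X : (Submodule ℝ (Fin n → ℝ))ᵒᵈ |
      ∃ S : Set (Submodule ℝ (Fin n → ℝ)), S ⊆ A.hyperplanes ∧
        OrderDual.ofDual X = sInf S}.Finite := by
    refine (A.finite.finite_subsets.image fun S => OrderDual.toDual (sInf S)).subset ?_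
    rintro X ⟨S, hS, hX⟩
    exact ⟨S, hS, hX.symm⟩
  exact h.to_subtype

instance (A : Arrangement n) : Fintype A.IntersectionLattice := Fintype.ofFinite _

open Classical in
instance (A : Arrangement n) : LocallyFiniteOrder A.IntersectionLattice :=
  Fintype.toLocallyFiniteOrder

/-- The minimal element `ℝ^n` of the intersection lattice. -/
instance (A : Arrangement n) : OrderBot A.IntersectionLattice where
  bot := ⟨OrderDual.toDual ⊤, ∅, Set.empty_subset _, sInf_empty.symm⟩
  bot_le _ := (le_top : _ ≤ (⊤ : Submodule ℝ (Fin n → ℝ)))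

open Classical in
/-- The characteristic polynomial `χ(A, t) = ∑_{X ∈ L(A)} μ(X) t ^ dim X`, where
`μ(X) = μ(0̂, X)` is the Möbius function of the intersection lattice. -/
def charPoly (A : Arrangement n) : Polynomial ℤ :=
  ∑ X : A.IntersectionLattice,
    Polynomial.C (IncidenceAlgebra.mu ℤ (⊥ : A.IntersectionLattice) X) *
      Polynomial.X ^ Module.finrank ℝ X.space

/-- The exponents of an arrangement: the (complex) roots of its characteristic polynomial, with
multiplicity. -/
def exponents (A : Arrangement n) : Multiset ℂ :=
  A.charPoly.aroots ℂ

end Arrangement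

/-! ### Derivations and freeness -/

/-- `α` is a homogeneous linear polynomial with zero set `H`. -/
def IsDefiningForm {n : ℕ} (H : Submodule ℝ (Fin n → ℝ)) (α : Poly n) : Prop :=
  α.IsHomogeneous 1 ∧ ∀ x : Fin n → ℝ, x ∈ H ↔ eval x α = 0

namespace Arrangement

variable {n : ℕ}

/-- The module `D(A)` of `A`-derivations: the derivations `θ` with `α_H ∣ θ(α_H)` for all
`H ∈ A`. (The defining form `α_H` is determined by `H` up to a nonzero scalar, which does not
affect the condition.) -/
def derivations (A : Arrangement n) : Submodule (Poly n) (Der n) where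
  carrier := {θ | ∀ H ∈ A.hyperplanes, ∀ α : Poly n, IsDefiningForm H α → α ∣ θ α}
  zero_mem' := fun _ _ α _ => by simp
  add_mem' := fun {a b} ha hb H hH α hα => by
    rw [Derivation.add_apply]
    exact dvd_add (ha H hH α hα) (hb H hH α hα)
  smul_mem' := fun c θ hθ H hH α hα => by
    rw [Derivation.smul_apply, smul_eq_mul]
    exact Dvd.dvd.mul_left (hθ H hH α hα) c

/-- An arrangement is free if its module of derivations is a free module over the polynomial
algebra. -/
def IsFree (A : Arrangement n) : Prop :=
  Module.Free (Poly n) A.derivations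

/-- `Q` is a defining polynomial `∏_{H ∈ A} α_H` of `A`, for some choice of the linear forms
`α_H`. -/
def IsDefiningPolynomial (A : Arrangement n) (Q : Poly n) : Prop :=
  ∃ α : Submodule ℝ (Fin n → ℝ) → Poly n,
    (∀ H ∈ A.hyperplanes, IsDefiningForm H (α H)) ∧ Q = ∏ H ∈ A.finite.toFinset, α H

end Arrangement

/-- The derivation `θ` has degree `d ∈ ℤ`: it maps homogeneous polynomials of degree `i` to
homogeneous polynomials of degree `i + d` (only `0` being homogeneous of negative degree). -/
def HasDegree {n : ℕ} (θ : Der n) (d : ℤ) : Prop :=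
  ∀ (i : ℕ) (f : Poly n), f.IsHomogeneous i →
    θ f = 0 ∨ ∃ m : ℕ, (m : ℤ) = i + d ∧ (θ f).IsHomogeneous m

/-! ### The arrangements of types `B` and `D` and those between them -/

/-- The hyperplane `x_i = 0`. -/
def coordPlane {n : ℕ} (i : Fin n) : Submodule ℝ (Fin n → ℝ) :=
  LinearMap.ker (LinearMap.proj i : (Fin n → ℝ) →ₗ[ℝ] ℝ)

/-- The hyperplane `x_i - x_j = 0`. -/
def minusPlane {n : ℕ} (i j : Fin n) : Submodule ℝ (Fin n → ℝ) :=
  LinearMap.ker ((LinearMap.proj i : (Fin n → ℝ) →ₗ[ℝ] ℝ) - LinearMap.proj j)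

/-- The hyperplane `x_i + x_j = 0`. -/
def plusPlane {n : ℕ} (i j : Fin n) : Submodule ℝ (Fin n → ℝ) :=
  LinearMap.ker ((LinearMap.proj i : (Fin n → ℝ) →ₗ[ℝ] ℝ) + LinearMap.proj j)

/-- The set of hyperplanes `x_i ± x_j = 0`, `i < j`. -/
def rootPlanesD (n : ℕ) : Set (Submodule ℝ (Fin n → ℝ)) :=
  {H | ∃ i j : Fin n, i < j ∧ (H = minusPlane i j ∨ H = plusPlane i j)}

theorem finrank_ker_add_one {n : ℕ} (f : (Fin n → ℝ) →ₗ[ℝ] ℝ) (x : Fin n → ℝ) (hx : f x ≠ 0) :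
    Module.finrank ℝ (LinearMap.ker f) + 1 = n := by
  have hf : f ≠ 0 := fun h => hx (by simp [h])
  have h := Module.Dual.finrank_ker_add_one_of_ne_zero (f := f) hf
  simpa using h

theorem finrank_coordPlane {n : ℕ} (i : Fin n) : Module.finrank ℝ (coordPlane i) + 1 = n :=
  finrank_ker_add_one _ (Pi.single i 1) (by simp)

theorem finrank_of_mem_rootPlanesD {n : ℕ} {H : Submodule ℝ (Fin n → ℝ)}
    (hH : H ∈ rootPlanesD n) : Module.finrank ℝ H + 1 = n := by
  obtain ⟨i, j, hij, rfl | rfl⟩ := hH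
  · exact finrank_ker_add_one _ (Pi.single i 1) (by simp [hij.ne'])
  · exact finrank_ker_add_one _ (Pi.single i 1) (by simp [hij.ne'])

theorem finite_rootPlanesD (n : ℕ) : (rootPlanesD n).Finite := by
  refine ((Set.finite_range fun p : Fin n × Fin n => minusPlane p.1 p.2).union
    (Set.finite_range fun p : Fin n × Fin n => plusPlane p.1 p.2)).subset ?_
  rintro H ⟨i, j, -, rfl | rfl⟩
  · exact Or.inl ⟨(i, j), rfl⟩
  · exact Or.inr ⟨(i, j), rfl⟩

/-- The Weyl arrangement `D_n = {x_i ± x_j = 0 : 1 ≤ i < j ≤ n}`. -/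
def weylD (n : ℕ) : Arrangement n where
  hyperplanes := rootPlanesD n
  finite := finite_rootPlanesD n
  dim _ hH := finrank_of_mem_rootPlanesD hH

/-- The Weyl arrangement
`B_n = {x_i ± x_j = 0 : 1 ≤ i < j ≤ n} ∪ {x_i = 0 : 1 ≤ i ≤ n}`. -/
def weylB (n : ℕ) : Arrangement n where
  hyperplanes := rootPlanesD n ∪ {H | ∃ i : Fin n, H = coordPlane i}
  finite := (finite_rootPlanesD n).union <|
    (Set.finite_range coordPlane).subset (by rintro H ⟨i, rfl⟩; exact ⟨i, rfl⟩)
  dim := by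
    rintro H (hH | ⟨i, rfl⟩)
    · exact finrank_of_mem_rootPlanesD hH
    · exact finrank_coordPlane i

/-- The arrangement `DB_{n,k}`: the hyperplanes of `D_n` together with the first `k` coordinate
hyperplanes (which are indexed here by `i = 0, …, k - 1`). -/
def arrDB (n k : ℕ) : Arrangement n where
  hyperplanes := (weylD n).hyperplanes ∪ {H | ∃ i : Fin n, (i : ℕ) < k ∧ H = coordPlane i}
  finite := (weylD n).finite.union <|
    (Set.finite_range coordPlane).subset (by rintro H ⟨i, -, rfl⟩; exact ⟨i, rfl⟩)
  dim := by
    rintro H (hH | ⟨i, -, rfl⟩)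
    · exact (weylD n).dim H hH
    · exact finrank_coordPlane i

/-- The polynomial `x_1 ⋯ x_k ∏_{i < j} (x_i ^ 2 - x_j ^ 2)`. -/
def polyDB (n k : ℕ) : Poly n :=
  (∏ i ∈ Finset.univ.filter (fun i : Fin n => (i : ℕ) < k), X i) *
    ∏ p ∈ Finset.univ.filter (fun p : Fin n × Fin n => p.1 < p.2), (X p.1 ^ 2 - X p.2 ^ 2)

/-! ### The derivations -/

/-- `X^d = x_1^d ∂/∂x_1 + ⋯ + x_n^d ∂/∂x_n`. -/
def powerDer (n d : ℕ) : Der n :=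
  ∑ i : Fin n, (X i ^ d : Poly n) • pderiv i

/-- `X̂ = x̂_1 ∂/∂x_1 + ⋯ + x̂_n ∂/∂x_n`, where `x̂_i` is the product of all variables
except `x_i`. -/
def hatDer (n : ℕ) : Der n :=
  ∑ i : Fin n, (∏ j ∈ Finset.univ.erase i, X j : Poly n) • pderiv i

/-- `θ_k = x_1 x_2 ⋯ x_k X̂`. -/
def thetaDer (n k : ℕ) : Der n :=
  (∏ i ∈ Finset.univ.filter (fun i : Fin n => (i : ℕ) < k), X i : Poly n) • hatDer n

/-- The sequence `X^1, X^3, …, X^{2n-3}, θ_k` of length `n`, indexed from `0`. -/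
def basisDB (n k : ℕ) (j : Fin n) : Der n :=
  if (j : ℕ) + 1 < n then powerDer n (2 * j + 1) else thetaDer n k

/-- The sequence `1, 3, …, 2n-3, n-1+k` of length `n`, indexed from `0`. -/
def exponentDB (n k : ℕ) (j : Fin n) : ℕ :=
  if (j : ℕ) + 1 < n then 2 * j + 1 else n - 1 + k

/-- The matrix `[θ_j(x_i)]` whose columns are the coefficient vectors of given derivations. -/
def coeffMatrix {n : ℕ} (θ : Fin n → Der n) : Matrix (Fin n) (Fin n) (Poly n) :=
  Matrix.of fun i j => θ j (X i)

end HyperplaneArr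

end

/-!
The statement has two independent halves, the structure of the module of derivations and the roots
of the characteristic polynomial.

**Freeness.** The derivations `X^1, X^3, …, X^{2n-3}, θ_k` preserve every hyperplane of `DB_{n,k}`
(`basisDB_mem`). After the `i`-th row of their coefficient matrix is multiplied by `x_i`, the matrix
is a Vandermonde matrix in the `x_i ^ 2`, up to a cyclic permutation of the columns and a factor in
the last column; this gives the determinant (`det_coeffMatrix_basisDB`). Saito's criterion
(`Arrangement.exists_basis_of_det_eq`) then shows that they form a basis: the determinant of any
`n` elements of `D(A)` is divisible by all the linear forms `α_H`, hence by their product `Q`, since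
forms of different hyperplanes are coprime; so Cramer's rule writes every element of `D(A)` in
terms of `n` elements whose determinant is `Q` up to a unit.

**Exponents.** For odd `q = 2m + 1`, let `W` be a symmetric set of `q` real numbers containing `0`.
Every intersection `X` of the hyperplanes has exactly `q ^ dim X` points with all coordinates in
`W`, because `X` is parametrized by some of the coordinates and every other one is `0` or, up to
sign, one of these (`card_filter_mem_sInf`). Möbius inversion makes `χ(q)` the number of points of
`W ^ n` off the arrangement (`Arrangement.charPoly_eval_eq_card`). These are the points whose
coordinates have different absolute values, with the first `k` coordinates nonzero; counting them
by their at most one zero coordinate (`card_injective_abs`) gives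
`χ(q) = (q - 1)(q - 3) ⋯ (q - (2n - 3)) (q - (n - 1 + k))` for all large odd `q`, hence identically
(`arrDB_charPoly`).
-/

namespace HyperplaneArr

open MvPolynomial

/-! ### Defining forms of hyperplanes -/

theorem exists_eq_sum_of_isHomogeneous_one {n : ℕ} {α : Poly n} (hα : α.IsHomogeneous 1) :
    ∃ a : Fin n → ℝ, α = ∑ i, a i • X i := by
  rw [← mem_homogeneousSubmodule, homogeneousSubmodule_one_eq_span_X,
    Submodule.mem_span_range_iff_exists_fun] at hα
  obtain ⟨a, ha⟩ := hα
  exact ⟨a, ha.symm⟩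

theorem IsDefiningForm.dvd_of_le {n : ℕ} {H H' : Submodule ℝ (Fin n → ℝ)} {α β : Poly n}
    (hα : IsDefiningForm H α) (hβ : IsDefiningForm H' β) (h : H ≤ H') : α ∣ β := by
  obtain ⟨a, rfl⟩ := exists_eq_sum_of_isHomogeneous_one hα.1
  obtain ⟨b, rfl⟩ := exists_eq_sum_of_isHomogeneous_one hβ.1
  -- both forms are evaluated by linear functionals, and a functional vanishing on the kernel of
  -- another one is a multiple of it
  let f : (Fin n → ℝ) → Module.Dual ℝ (Fin n → ℝ) := fun c => ∑ i, c i • LinearMap.proj i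
  have hf : ∀ c x, f c x = eval x (∑ i, c i • X i : Poly n) := by
    intro c x
    simp [f, smul_eval]
  have hker : LinearMap.ker (f a) ≤ LinearMap.ker (f b) := by
    intro x hx
    rw [LinearMap.mem_ker, hf] at hx ⊢
    exact (hβ.2 x).1 (h ((hα.2 x).2 hx))
  have hmem : f b ∈ Submodule.span ℝ (Set.range fun _ : Unit => f a) :=
    mem_span_of_iInf_ker_le_ker (by simpa using hker)
  rw [Set.range_const, Submodule.mem_span_singleton] at hmem
  obtain ⟨c, hc⟩ := hmem
  refine ⟨C c, ?_⟩
  have hb : ∀ i, b i = c * a i := by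
    intro i
    have := LinearMap.congr_fun hc (Pi.single i 1)
    simpa [f, Pi.single_apply, Finset.sum_ite_eq, eq_comm] using this
  rw [Finset.sum_mul]
  refine Finset.sum_congr rfl fun i _ => ?_
  rw [hb, smul_eq_C_mul, smul_eq_C_mul, C_mul]
  ring

theorem IsDefiningForm.le_of_dvd {n : ℕ} {H H' : Submodule ℝ (Fin n → ℝ)} {α β : Poly n}
    (hα : IsDefiningForm H α) (hβ : IsDefiningForm H' β) (h : α ∣ β) : H ≤ H' := by
  intro x hx
  obtain ⟨γ, rfl⟩ := h
  rw [hβ.2, map_mul, (hα.2 x).1 hx, zero_mul]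

theorem IsDefiningForm.ne_zero {n : ℕ} {H : Submodule ℝ (Fin n → ℝ)} {α : Poly n}
    (hα : IsDefiningForm H α) (hH : Module.finrank ℝ H + 1 = n) : α ≠ 0 := by
  rintro rfl
  have : H = ⊤ := eq_top_iff.2 fun x _ => (hα.2 x).2 (map_zero _)
  rw [this, finrank_top, Module.finrank_fin_fun] at hH
  omega

theorem IsDefiningForm.irreducible {n : ℕ} {H : Submodule ℝ (Fin n → ℝ)} {α : Poly n}
    (hα : IsDefiningForm H α) (hH : Module.finrank ℝ H + 1 = n) : Irreducible α := by
  refine irreducible_of_totalDegree_eq_one (hα.1.totalDegree (hα.ne_zero hH)) fun x hx => ?_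
  refine isUnit_iff_ne_zero.2 fun h0 => hα.ne_zero hH ?_
  ext m
  simpa [h0] using hx m

/-- Forms defining different hyperplanes have no common factor. -/
theorem IsDefiningForm.isRelPrime {n : ℕ} {H H' : Submodule ℝ (Fin n → ℝ)} {α β : Poly n}
    (hα : IsDefiningForm H α) (hβ : IsDefiningForm H' β) (hH : Module.finrank ℝ H + 1 = n)
    (hH' : Module.finrank ℝ H' + 1 = n) (hne : H ≠ H') : IsRelPrime α β := by
  rw [(hα.irreducible hH).isRelPrime_iff_not_dvd]
  intro h
  exact hne (Submodule.eq_of_le_of_finrank_eq (hα.le_of_dvd hβ h) (by omega))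

/-! ### Saito's criterion -/

namespace Arrangement

variable {n : ℕ}

/-- To test `θ ∈ D(A)`, one defining form for each hyperplane is enough. -/
theorem mem_derivations_of_forall_exists (A : Arrangement n) (θ : Der n)
    (h : ∀ H ∈ A.hyperplanes, ∃ α : Poly n, IsDefiningForm H α ∧ α ∣ θ α) :
    θ ∈ A.derivations := by
  intro H hH β hβ
  obtain ⟨α, hα, hdvd⟩ := h H hH
  obtain ⟨γ, rfl⟩ := hα.dvd_of_le hβ le_rfl
  have hγ : α * γ ∣ α := hβ.dvd_of_le hα le_rfl
  rw [Derivation.leibniz, smul_eq_mul, smul_eq_mul]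
  exact dvd_add (hγ.mul_right _) ((hγ.trans hdvd).mul_left γ)

theorem dvd_det_coeffMatrix (A : Arrangement n) {θ : Fin n → Der n}
    (hθ : ∀ j, θ j ∈ A.derivations) {H : Submodule ℝ (Fin n → ℝ)} (hH : H ∈ A.hyperplanes)
    {α : Poly n} (hα : IsDefiningForm H α) : α ∣ (coeffMatrix θ).det := by
  obtain ⟨a, ha⟩ := exists_eq_sum_of_isHomogeneous_one hα.1
  obtain ⟨i, hi⟩ : ∃ i, a i ≠ 0 := by
    by_contra! h
    exact hα.ne_zero (A.dim H hH) (by simp [ha, h])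
  choose r hr using fun j => hθ j H hH α hα
  -- the combination of the rows with the coefficients of `α` is the row of the `θ j α`
  have hrow : ∑ l, (C (a l) : Poly n) • coeffMatrix θ l = α • r := by
    ext1 j
    rw [Pi.smul_apply, smul_eq_mul, ← hr, ha, map_sum, Finset.sum_apply]
    refine Finset.sum_congr rfl fun l _ => ?_
    rw [Derivation.map_smul, Pi.smul_apply, smul_eq_mul, smul_eq_C_mul]
    rfl
  have hdet := Matrix.det_updateRow_sum (coeffMatrix θ) i fun l => (C (a l) : Poly n)
  rw [hrow, Matrix.det_updateRow_smul] at hdet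
  have : (coeffMatrix θ).det = α * (C (a i)⁻¹ *
      ((coeffMatrix θ).updateRow i r).det) := by
    rw [mul_left_comm, hdet, smul_eq_mul, ← mul_assoc, ← C_mul, inv_mul_cancel₀ hi, C_1, one_mul]
  exact ⟨_, this⟩

theorem IsDefiningPolynomial.dvd_det_coeffMatrix {A : Arrangement n} {Q : Poly n}
    (hQ : A.IsDefiningPolynomial Q) {θ : Fin n → Der n} (hθ : ∀ j, θ j ∈ A.derivations) :
    Q ∣ (coeffMatrix θ).det := by
  obtain ⟨α, hα, rfl⟩ := hQ
  refine Finset.prod_dvd_of_isRelPrime ?_ fun H hH =>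
    A.dvd_det_coeffMatrix hθ (A.finite.mem_toFinset.1 hH) (hα H (A.finite.mem_toFinset.1 hH))
  intro H hH H' hH' hne
  have h := A.finite.mem_toFinset.1 (Finset.mem_coe.1 hH)
  have h' := A.finite.mem_toFinset.1 (Finset.mem_coe.1 hH')
  exact (hα H h).isRelPrime (hα H' h') (A.dim H h) (A.dim H' h') hne

theorem IsDefiningPolynomial.ne_zero {A : Arrangement n} {Q : Poly n}
    (hQ : A.IsDefiningPolynomial Q) : Q ≠ 0 := by
  obtain ⟨α, hα, rfl⟩ := hQ
  refine Finset.prod_ne_zero_iff.2 fun H hH => ?_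
  rw [A.finite.mem_toFinset] at hH
  exact (hα H hH).ne_zero (A.dim H hH)

/-- Saito's criterion: derivations in `D(A)` whose coefficient matrix has determinant a unit times
the defining polynomial are a basis of `D(A)`. -/
theorem exists_basis_of_det_eq {A : Arrangement n} {Q : Poly n} (hQ : A.IsDefiningPolynomial Q)
    {θ : Fin n → Der n} (hθ : ∀ j, θ j ∈ A.derivations) {u : Poly n} (hu : IsUnit u)
    (hdet : (coeffMatrix θ).det = u * Q) :
    ∃ b : Module.Basis (Fin n) (Poly n) A.derivations, ∀ j, (b j : Der n) = θ j := by
  have hdet0 : (coeffMatrix θ).det ≠ 0 := by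
    rw [hdet]
    exact mul_ne_zero hu.ne_zero hQ.ne_zero
  have hcomb : ∀ g : Fin n → Poly n, ∀ i,
      (∑ j, g j • θ j) (X i) = (coeffMatrix θ).mulVec g i := by
    intro g i
    have : (∑ j, g j • θ j) (X i) = ∑ j, g j * θ j (X i) := by
      rw [← Derivation.coeFnAddMonoidHom_apply, map_sum, Finset.sum_apply]
      rfl
    rw [this, Matrix.mulVec, dotProduct]
    exact Finset.sum_congr rfl fun j _ => mul_comm _ _
  have hli : LinearIndependent (Poly n) θ := by
    rw [Fintype.linearIndependent_iff]
    intro g hg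
    have h0 : (coeffMatrix θ).mulVec g = 0 := by
      ext1 i
      rw [← hcomb, hg]
      rfl
    exact congrFun (Matrix.eq_zero_of_mulVec_eq_zero hdet0 h0)
  -- Cramer's rule: the coefficients with respect to `θ` are quotients of determinants, and both
  -- are divisible by `Q`
  have hspan : ∀ η ∈ A.derivations, ∃ g : Fin n → Poly n, ∑ j, g j • θ j = η := by
    intro η hη
    let v : Fin n → Poly n := fun i => η (X i)
    have hdvd : ∀ j, (coeffMatrix θ).det ∣ (coeffMatrix θ).cramer v j := by
      intro j
      have hcol : (coeffMatrix θ).updateCol j v = coeffMatrix (Function.update θ j η) := by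
        ext1 i l
        by_cases hl : l = j
        · subst hl
          simp [coeffMatrix, v]
        · simp [coeffMatrix, hl]
      rw [Matrix.cramer_apply, hcol, hdet, hu.mul_left_dvd]
      refine hQ.dvd_det_coeffMatrix fun l => ?_
      by_cases hl : l = j
      · subst hl
        simpa using hη
      · simpa [hl] using hθ l
    choose g hg using hdvd
    refine ⟨g, derivation_ext fun i => ?_⟩
    rw [hcomb]
    have hc := congrFun (Matrix.mulVec_cramer (coeffMatrix θ) v) i
    have hgv : (coeffMatrix θ).cramer v = (coeffMatrix θ).det • g := funext hg
    rw [hgv, Matrix.mulVec_smul, Pi.smul_apply, Pi.smul_apply, smul_eq_mul, smul_eq_mul] at hc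
    exact mul_left_cancel₀ hdet0 hc
  let θ' : Fin n → A.derivations := fun j => ⟨θ j, hθ j⟩
  have hli' : LinearIndependent (Poly n) θ' :=
    LinearIndependent.of_comp A.derivations.subtype hli
  refine ⟨Module.Basis.mk hli' ?_, fun j => by rw [Module.Basis.mk_apply]⟩
  rintro ⟨η, hη⟩ -
  obtain ⟨g, hg⟩ := hspan η hη
  refine (Submodule.mem_span_range_iff_exists_fun _).2 ⟨g, Subtype.ext ?_⟩
  simpa [θ'] using hg

end Arrangement

end HyperplaneArr

namespace HyperplaneArr

open MvPolynomial

/-! ### The hyperplanes and the defining polynomial of the interpolating arrangements -/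

theorem Arrangement.isDefiningPolynomial_prod {n : ℕ} (A : Arrangement n) {ι : Type*} [Fintype ι]
    (plane : ι → Submodule ℝ (Fin n → ℝ)) (form : ι → Poly n) (hinj : Function.Injective plane)
    (hrange : Set.range plane = A.hyperplanes) (hform : ∀ a, IsDefiningForm (plane a) (form a)) :
    A.IsDefiningPolynomial (∏ a, form a) := by
  classical
  refine ⟨Function.extend plane form 0, fun H hH => ?_, ?_⟩
  · obtain ⟨a, rfl⟩ := hrange.symm ▸ hH
    rw [hinj.extend_apply]
    exact hform a
  · have : A.finite.toFinset = Finset.univ.image plane := by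
      ext H
      simp [← hrange]
    rw [this, Finset.prod_image hinj.injOn]
    exact Finset.prod_congr rfl fun a _ => (hinj.extend_apply _ _ a).symm

/-- Index set for the hyperplanes of `DB_{n,k}`: the `i` with `x_i = 0` in the arrangement, and the
pairs `i < j` with a sign, where `true` stands for `x_i - x_j` and `false` for `x_i + x_j`. -/
abbrev IndexDB (n k : ℕ) : Type :=
  {i : Fin n // (i : ℕ) < k} ⊕ {p : Fin n × Fin n // p.1 < p.2} × Bool

/-- The hyperplane of `DB_{n,k}` with a given index. -/
def planeDB (n k : ℕ) : IndexDB n k → Submodule ℝ (Fin n → ℝ)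
  | .inl i => coordPlane i.1
  | .inr (p, true) => minusPlane p.1.1 p.1.2
  | .inr (p, false) => plusPlane p.1.1 p.1.2

/-- The linear form of the hyperplane of `DB_{n,k}` with a given index. -/
noncomputable def formDB (n k : ℕ) : IndexDB n k → Poly n
  | .inl i => X i.1
  | .inr (p, true) => X p.1.1 - X p.1.2
  | .inr (p, false) => X p.1.1 + X p.1.2

theorem mem_coordPlane {n : ℕ} {i : Fin n} {x : Fin n → ℝ} : x ∈ coordPlane i ↔ x i = 0 := by
  simp [coordPlane]

theorem mem_minusPlane {n : ℕ} {i j : Fin n} {x : Fin n → ℝ} :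
    x ∈ minusPlane i j ↔ x i = x j := by
  simp [minusPlane, sub_eq_zero]

theorem mem_plusPlane {n : ℕ} {i j : Fin n} {x : Fin n → ℝ} :
    x ∈ plusPlane i j ↔ x i = -x j := by
  simp [plusPlane, add_eq_zero_iff_eq_neg]

theorem isDefiningForm_formDB (n k : ℕ) (a : IndexDB n k) :
    IsDefiningForm (planeDB n k a) (formDB n k a) := by
  rcases a with i | ⟨p, _ | _⟩
  · exact ⟨isHomogeneous_X _ _, fun x => by simp [planeDB, formDB, mem_coordPlane]⟩
  · exact ⟨(isHomogeneous_X _ _).add (isHomogeneous_X _ _), fun x => by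
      simp [planeDB, formDB, mem_plusPlane, add_eq_zero_iff_eq_neg]⟩
  · exact ⟨(isHomogeneous_X _ _).sub (isHomogeneous_X _ _), fun x => by
      simp [planeDB, formDB, mem_minusPlane, sub_eq_zero]⟩

theorem range_planeDB (n k : ℕ) : Set.range (planeDB n k) = (arrDB n k).hyperplanes := by
  ext H
  constructor
  · rintro ⟨i | ⟨p, _ | _⟩, rfl⟩
    · exact Or.inr ⟨i.1, i.2, rfl⟩
    · exact Or.inl ⟨p.1.1, p.1.2, p.2, Or.inr rfl⟩
    · exact Or.inl ⟨p.1.1, p.1.2, p.2, Or.inl rfl⟩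
  · rintro (⟨i, j, hij, rfl | rfl⟩ | ⟨i, hi, rfl⟩)
    · exact ⟨.inr (⟨(i, j), hij⟩, true), rfl⟩
    · exact ⟨.inr (⟨(i, j), hij⟩, false), rfl⟩
    · exact ⟨.inl ⟨i, hi⟩, rfl⟩

/-- The coordinates that occur in the equation of a hyperplane of `DB_{n,k}`. -/
theorem single_notMem_planeDB (n k : ℕ) (a : IndexDB n k) (l : Fin n) :
    Pi.single l 1 ∉ planeDB n k a ↔
      Sum.elim (fun i => l = i.1) (fun p => l = p.1.1.1 ∨ l = p.1.1.2) a := by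
  rcases a with i | ⟨⟨⟨i, j⟩, hij⟩, _ | _⟩
  · simp [planeDB, mem_coordPlane, Pi.single_apply, eq_comm]
  · have h : i ≠ j := hij.ne
    by_cases h1 : l = i <;> by_cases h2 : l = j <;>
      simp_all [planeDB, mem_plusPlane, eq_comm]
  · have h : i ≠ j := hij.ne
    by_cases h1 : l = i <;> by_cases h2 : l = j <;>
      simp_all [planeDB, mem_minusPlane, eq_comm]

theorem planeDB_injective (n k : ℕ) : Function.Injective (planeDB n k) := by
  intro a b hab
  have h : ∀ l, Sum.elim (fun i => l = i.1) (fun p => l = p.1.1.1 ∨ l = p.1.1.2) a ↔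
      Sum.elim (fun i => l = i.1) (fun p => l = p.1.1.1 ∨ l = p.1.1.2) b := fun l => by
    rw [← single_notMem_planeDB, ← single_notMem_planeDB, hab]
  rcases a with ⟨i, hi⟩ | ⟨⟨⟨i, j⟩, hij⟩, s⟩ <;> rcases b with ⟨i', hi'⟩ | ⟨⟨⟨i', j'⟩, hij'⟩, s'⟩ <;>
    simp only [Sum.elim_inl, Sum.elim_inr] at h
  · have := (h i).1 rfl
    subst this
    rfl
  · exact absurd (((h i').2 (Or.inl rfl)).trans ((h j').2 (Or.inr rfl)).symm) hij'.ne
  · exact absurd (((h i).1 (Or.inl rfl)).trans ((h j).1 (Or.inr rfl)).symm) hij.ne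
  · have hi := (h i).1 (Or.inl rfl)
    have hj := (h j).1 (Or.inr rfl)
    have hi' := (h i').2 (Or.inl rfl)
    have hj' := (h j').2 (Or.inr rfl)
    simp only at hij hij'
    obtain ⟨rfl, rfl⟩ : i = i' ∧ j = j' := by
      constructor <;> omega
    -- the sign is detected by the vector `e_i + e_j`, which lies on `x_i - x_j = 0` only
    have hs : ∀ t : Bool, Pi.single i 1 + Pi.single j 1 ∈
        planeDB n k (.inr (⟨(i, j), hij⟩, t)) ↔ t = true := by
      rintro (_ | _)
      · simp only [planeDB, mem_plusPlane]
        simp [hij.ne, hij.ne']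
        norm_num
      · simp [planeDB, mem_minusPlane, hij.ne, hij.ne']
    have : s = s' := by
      rw [Bool.eq_iff_iff, ← hs s, hab, hs s']
    rw [this]

theorem polyDB_eq_prod (n k : ℕ) : polyDB n k = ∏ a, formDB n k a := by
  rw [Fintype.prod_sum_type, Fintype.prod_prod_type, polyDB]
  congr 1
  · exact (Finset.prod_subtype _ (by simp) _)
  · rw [Finset.prod_subtype (p := fun p : Fin n × Fin n => p.1 < p.2) _ (by simp) _]
    refine Finset.prod_congr rfl fun p _ => ?_
    rw [Fintype.prod_bool]
    simp only [formDB]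
    ring

theorem isDefiningPolynomial_polyDB (n k : ℕ) : (arrDB n k).IsDefiningPolynomial (polyDB n k) := by
  rw [polyDB_eq_prod]
  exact (arrDB n k).isDefiningPolynomial_prod _ _ (planeDB_injective n k) (range_planeDB n k)
    (isDefiningForm_formDB n k)

theorem arrDB_zero (n : ℕ) : arrDB n 0 = weylD n := by
  ext H
  simp [arrDB]

theorem arrDB_self (n : ℕ) : arrDB n n = weylB n := by
  ext H
  simp [arrDB, weylB, weylD]

/-! ### The derivations of the interpolating arrangements -/

theorem sum_smul_pderiv_apply_X {n : ℕ} (c : Fin n → Poly n) (i : Fin n) :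
    (∑ l, c l • pderiv l : Der n) (X i) = c i := by
  have : (∑ l, c l • pderiv l : Der n) (X i) = ∑ l, c l * pderiv l (X i) := by
    rw [← Derivation.coeFnAddMonoidHom_apply, map_sum, Finset.sum_apply]
    rfl
  rw [this]
  simp [pderiv_X, Pi.single_apply]

theorem powerDer_X (n d : ℕ) (i : Fin n) : powerDer n d (X i) = X i ^ d :=
  sum_smul_pderiv_apply_X _ i

theorem hatDer_X (n : ℕ) (i : Fin n) : hatDer n (X i) = ∏ j ∈ Finset.univ.erase i, X j :=
  sum_smul_pderiv_apply_X _ i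

theorem thetaDer_X (n k : ℕ) (i : Fin n) : thetaDer n k (X i) =
    (∏ i ∈ Finset.univ.filter (fun i : Fin n => (i : ℕ) < k), X i) *
      ∏ j ∈ Finset.univ.erase i, X j := by
  rw [thetaDer, Derivation.smul_apply, hatDer_X, smul_eq_mul]

theorem powerDer_mem {n k d : ℕ} (hd : Odd d) : powerDer n d ∈ (arrDB n k).derivations := by
  refine (arrDB n k).mem_derivations_of_forall_exists _ fun H hH => ?_
  rw [← range_planeDB] at hH
  obtain ⟨a, rfl⟩ := hH
  refine ⟨_, isDefiningForm_formDB n k a, ?_⟩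
  rcases a with i | ⟨p, _ | _⟩ <;> simp only [formDB, map_add, map_sub, powerDer_X]
  · exact dvd_pow_self _ hd.pos.ne'
  · exact hd.add_dvd_pow_add_pow _ _
  · exact sub_dvd_pow_sub_pow _ _ _

theorem thetaDer_mem (n k : ℕ) : thetaDer n k ∈ (arrDB n k).derivations := by
  refine (arrDB n k).mem_derivations_of_forall_exists _ fun H hH => ?_
  rw [← range_planeDB] at hH
  obtain ⟨a, rfl⟩ := hH
  refine ⟨_, isDefiningForm_formDB n k a, ?_⟩
  -- the products without `x_i` and without `x_j` have all other variables in common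
  have hsplit : ∀ i j : Fin n, i ≠ j → (∏ l ∈ Finset.univ.erase i, X l : Poly n) =
      X j * ∏ l ∈ (Finset.univ.erase i).erase j, X l := fun i j hij =>
    (Finset.mul_prod_erase _ _ (by simp [hij.symm])).symm
  rcases a with i | ⟨⟨⟨i, j⟩, hij⟩, _ | _⟩ <;> simp only [formDB, map_add, map_sub, thetaDer_X]
  · exact Dvd.dvd.mul_right (Finset.dvd_prod_of_mem _ (by simp [i.2])) _
  · rw [hsplit i j hij.ne, hsplit j i hij.ne', Finset.erase_right_comm, ← mul_add, ← add_mul]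
    exact ((dvd_of_eq (add_comm _ _)).mul_right _).mul_left _
  · rw [hsplit i j hij.ne, hsplit j i hij.ne', Finset.erase_right_comm, ← mul_sub, ← sub_mul]
    exact (((dvd_neg.2 (dvd_refl _)).trans (dvd_of_eq (neg_sub _ _))).mul_right _).mul_left _

theorem basisDB_mem (n k : ℕ) (j : Fin n) : basisDB n k j ∈ (arrDB n k).derivations := by
  rw [basisDB]
  split_ifs
  · exact powerDer_mem (odd_two_mul_add_one _)
  · exact thetaDer_mem n k

theorem hasDegree_of_isHomogeneous {n : ℕ} {θ : Der n} {e : ℕ}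
    (h : ∀ i, (θ (X i)).IsHomogeneous e) : HasDegree θ ((e : ℤ) - 1) := by
  intro i f hf
  have hθ : θ f = ∑ l, θ (X l) * pderiv l f := by
    have : θ = ∑ l, θ (X l) • pderiv l :=
      derivation_ext fun i => (sum_smul_pderiv_apply_X (fun l => θ (X l)) i).symm
    conv_lhs => rw [this]
    rw [← Derivation.coeFnAddMonoidHom_apply, map_sum, Finset.sum_apply]
    rfl
  rcases i with _ | i
  · left
    rw [← totalDegree_zero_iff_isHomogeneous, totalDegree_eq_zero_iff_eq_C] at hf
    rw [hf]
    exact derivation_C θ _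
  · right
    refine ⟨e + i, by push_cast; ring, ?_⟩
    rw [hθ]
    exact IsHomogeneous.sum _ _ _ fun l _ => (h l).mul hf.pderiv

theorem hasDegree_basisDB {n k : ℕ} (hk : k ≤ n) (j : Fin n) :
    HasDegree (basisDB n k j) ((exponentDB n k j : ℤ) - 1) := by
  refine hasDegree_of_isHomogeneous fun i => ?_
  rw [basisDB, exponentDB]
  split_ifs
  · rw [powerDer_X]
    exact isHomogeneous_X_pow _ _
  · rw [thetaDer_X, add_comm]
    have hprod : ∀ s : Finset (Fin n), (∏ l ∈ s, X l : Poly n).IsHomogeneous s.card := fun s => by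
      simpa using IsHomogeneous.prod s (fun l => (X l : Poly n)) (fun _ => 1)
        fun l _ => isHomogeneous_X _ _
    convert (hprod _).mul (hprod _) using 2
    · rw [Fin.card_filter_val_lt, min_eq_right hk]
    · simp

/-! ### The determinant -/

theorem sum_fin_sub (m : ℕ) : ∑ i : Fin (m + 1), (m - (i : ℕ)) = (m + 1) * m / 2 := by
  rw [Fin.sum_univ_eq_sum_range (fun i => m - i) (m + 1)]
  have := Finset.sum_range_reflect (fun i => i) (m + 1)
  simp only [Nat.add_sub_cancel] at this
  rw [this, Finset.sum_range_id, Nat.add_sub_cancel]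

/-- Multiplying the `i`-th row by `x_i` turns the coefficient matrix of the derivations into a
Vandermonde matrix in the squares of the variables, with its first column moved to the end and
multiplied by `x_1 ⋯ x_k` times the product of all variables. -/
theorem det_coeffMatrix_basisDB_mul (m k : ℕ) :
    (∏ i, X i : Poly (m + 1)) * (coeffMatrix (basisDB (m + 1) k)).det =
      (∏ i, X i) * ((-1) ^ m *
        (Matrix.vandermonde fun i : Fin (m + 1) => (X i ^ 2 : Poly (m + 1))).det *
        ∏ i ∈ Finset.univ.filter (fun i : Fin (m + 1) => (i : ℕ) < k), X i) := by
  set P : Poly (m + 1) := ∏ i, X i with hP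
  set c : Poly (m + 1) := ∏ i ∈ Finset.univ.filter (fun i : Fin (m + 1) => (i : ℕ) < k), X i
    with hc
  set V := Matrix.vandermonde fun i : Fin (m + 1) => (X i ^ 2 : Poly (m + 1)) with hV
  have hmat : Matrix.diagonal (fun i => (X i : Poly (m + 1))) * coeffMatrix (basisDB (m + 1) k) =
      V.submatrix id (finRotate (m + 1)) *
        Matrix.diagonal (fun j : Fin (m + 1) => if (j : ℕ) < m then 1 else P * c) := by
    ext1 i j
    rw [Matrix.diagonal_mul, Matrix.mul_diagonal, Matrix.submatrix_apply, id, hV,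
      Matrix.vandermonde_apply, coeffMatrix, Matrix.of_apply, basisDB]
    by_cases hj : (j : ℕ) < m
    · have hrot : (finRotate (m + 1) j : ℕ) = j + 1 :=
        coe_finRotate_of_ne_last (Fin.ne_of_val_ne (by simpa using hj.ne))
      rw [if_pos (by omega), if_pos hj, powerDer_X, hrot]
      ring
    · have hj' : j = Fin.last m := Fin.ext (by simp; omega)
      rw [if_neg (by omega), if_neg hj, hj', finRotate_last, thetaDer_X, Fin.val_zero, pow_zero,
        one_mul, hP, ← Finset.mul_prod_erase Finset.univ X (Finset.mem_univ i)]
      ring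
  have hdet := congrArg Matrix.det hmat
  rw [Matrix.det_mul, Matrix.det_diagonal, Matrix.det_mul, Matrix.det_permute', Matrix.det_diagonal,
    sign_finRotate, Fin.prod_univ_castSucc (fun j : Fin (m + 1) => if (j : ℕ) < m then 1 else P * c)]
    at hdet
  rw [hdet]
  simp
  ring

theorem det_vandermonde_sq (m : ℕ) :
    (Matrix.vandermonde fun i : Fin (m + 1) => (X i ^ 2 : Poly (m + 1))).det =
      (-1) ^ ((m + 1) * m / 2) *
        ∏ p ∈ Finset.univ.filter (fun p : Fin (m + 1) × Fin (m + 1) => p.1 < p.2),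
          (X p.1 ^ 2 - X p.2 ^ 2) := by
  have hpairs : ∏ p ∈ Finset.univ.filter (fun p : Fin (m + 1) × Fin (m + 1) => p.1 < p.2),
        (X p.1 ^ 2 - X p.2 ^ 2 : Poly (m + 1)) =
      ∏ i : Fin (m + 1), ∏ j ∈ Finset.Ioi i, (X i ^ 2 - X j ^ 2) :=
    Finset.prod_finset_product' _ Finset.univ Finset.Ioi (by simp)
      (f := fun i j => (X i ^ 2 - X j ^ 2 : Poly (m + 1)))
  have hsign : ((-1) ^ ((m + 1) * m / 2) : Poly (m + 1)) =
      ∏ i : Fin (m + 1), ∏ _j ∈ Finset.Ioi i, (-1) := by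
    simp only [Finset.prod_const, Fin.card_Ioi]
    rw [Finset.prod_pow_eq_pow_sum, ← sum_fin_sub]
    simp
  rw [Matrix.det_vandermonde, hpairs, hsign, ← Finset.prod_mul_distrib]
  refine Finset.prod_congr rfl fun i _ => ?_
  rw [← Finset.prod_mul_distrib]
  exact Finset.prod_congr rfl fun j _ => by ring

theorem det_coeffMatrix_basisDB {n k : ℕ} (hn : 1 ≤ n) :
    (coeffMatrix (basisDB n k)).det = (-1) ^ ((n - 1) * (n + 2) / 2) * polyDB n k := by
  obtain ⟨m, rfl⟩ : ∃ m, n = m + 1 := ⟨n - 1, by omega⟩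
  have h0 : (∏ i, X i : Poly (m + 1)) ≠ 0 := Finset.prod_ne_zero_iff.2 fun i _ => X_ne_zero i
  rw [mul_left_cancel₀ h0 (det_coeffMatrix_basisDB_mul m k), det_vandermonde_sq, polyDB]
  have hexp : (m + 1 - 1) * (m + 1 + 2) / 2 = m + (m + 1) * m / 2 := by
    rw [Nat.add_sub_cancel, show m * (m + 1 + 2) = (m + 1) * m + m * 2 by ring,
      Nat.add_mul_div_right _ _ two_pos, add_comm]
  rw [hexp, pow_add]
  ring

theorem exists_basis_basisDB {n k : ℕ} (hn : 1 ≤ n) :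
    ∃ b : Module.Basis (Fin n) (Poly n) (arrDB n k).derivations,
      ∀ j, (b j : Der n) = basisDB n k j :=
  Arrangement.exists_basis_of_det_eq (isDefiningPolynomial_polyDB n k) (basisDB_mem n k)
    (isUnit_one.neg.pow _) (det_coeffMatrix_basisDB hn)

end HyperplaneArr

namespace HyperplaneArr

/-! ### Counting points and the characteristic polynomial -/

namespace Arrangement

variable {n : ℕ}

/-- The smallest member of the intersection lattice that contains `x`: the intersection of the
hyperplanes through `x`. -/
def flatThrough (A : Arrangement n) (x : Fin n → ℝ) : A.IntersectionLattice :=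
  ⟨OrderDual.toDual (sInf {H ∈ A.hyperplanes | x ∈ H}), _, Set.sep_subset _ _, rfl⟩

theorem le_flatThrough_iff (A : Arrangement n) (x : Fin n → ℝ) (X : A.IntersectionLattice) :
    X ≤ A.flatThrough x ↔ x ∈ X.space := by
  rw [IntersectionLattice.le_iff]
  constructor
  · intro h
    exact h (Submodule.mem_sInf.2 fun H hH => hH.2)
  · intro hx
    obtain ⟨X, S, hS, hXS⟩ := X
    change x ∈ OrderDual.ofDual X at hx
    change _ ≤ OrderDual.ofDual X
    rw [hXS] at hx ⊢
    exact sInf_le_sInf fun H hH => ⟨hS hH, Submodule.mem_sInf.1 hx H hH⟩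

theorem flatThrough_eq_bot_iff (A : Arrangement n) (x : Fin n → ℝ) :
    ⊥ = A.flatThrough x ↔ ∀ H ∈ A.hyperplanes, x ∉ H := by
  constructor
  · intro h H hH hx
    have hle : (⊤ : Submodule ℝ (Fin n → ℝ)) ≤ H := by
      have h1 : (⊥ : A.IntersectionLattice).space = (A.flatThrough x).space := by rw [← h]
      have h2 : (A.flatThrough x).space ≤ H := sInf_le ⟨hH, hx⟩
      rwa [← h1] at h2
    have := A.dim H hH
    rw [top_le_iff.1 hle, finrank_top, Module.finrank_fin_fun] at this
    omega
  · intro h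
    refine Subtype.ext ?_
    have : {H ∈ A.hyperplanes | x ∈ H} = ∅ := by
      ext H
      simpa using h H
    simp only [flatThrough, this, sInf_empty]
    rfl

open Classical in
/-- If a finite set `B` of points meets every member `X` of the intersection lattice in
`q ^ dim X` points, then by Möbius inversion `χ(A, q)` is the number of points of `B` on no
hyperplane of `A`. -/
theorem charPoly_eval_eq_card (A : Arrangement n) (B : Finset (Fin n → ℝ)) (q : ℕ)
    (hB : ∀ X : A.IntersectionLattice,
      (B.filter (· ∈ X.space)).card = q ^ Module.finrank ℝ X.space) :
    A.charPoly.eval (q : ℤ) = (B.filter fun x => ∀ H ∈ A.hyperplanes, x ∉ H).card := by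
  have hterm : ∀ X : A.IntersectionLattice, (q : ℤ) ^ Module.finrank ℝ X.space =
      ∑ x ∈ B, if X ≤ A.flatThrough x then 1 else 0 := by
    intro X
    simp only [le_flatThrough_iff]
    rw [Finset.sum_boole, hB, Nat.cast_pow]
  rw [charPoly, Polynomial.eval_finsetSum]
  simp only [Polynomial.eval_mul, Polynomial.eval_C, Polynomial.eval_pow, Polynomial.eval_X, hterm,
    Finset.mul_sum]
  rw [Finset.sum_comm, ← Finset.sum_boole]
  refine Finset.sum_congr rfl fun x _ => ?_
  have hIcc : Finset.univ.filter (fun X => X ≤ A.flatThrough x) =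
      Finset.Icc ⊥ (A.flatThrough x) := by
    ext X
    simp
  simp only [mul_ite, mul_one, mul_zero]
  rw [← Finset.sum_filter, hIcc, IncidenceAlgebra.sum_Icc_mu_right]
  simp only [flatThrough_eq_bot_iff]

end Arrangement

open Classical in
/-- A subspace cut out by equations `x_i = 0` and `x_i = ± x_j` contains exactly `|W| ^ dim` points
with coordinates in `W`, if `W` is symmetric and contains `0`. -/
theorem card_filter_mem_sInf {n : ℕ} {S : Set (Submodule ℝ (Fin n → ℝ))}
    (hS : ∀ H ∈ S, ∃ (i j : Fin n) (ε : ℝ), (ε = 0 ∨ ε = 1 ∨ ε = -1) ∧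
      ∀ x, x ∈ H ↔ x i = ε * x j)
    {W : Finset ℝ} (hW0 : (0 : ℝ) ∈ W) (hWneg : ∀ w ∈ W, -w ∈ W) :
    ((Fintype.piFinset fun _ : Fin n => W).filter (· ∈ sInf S)).card =
      W.card ^ Module.finrank ℝ ↥(sInf S) := by
  set Y : Submodule ℝ (Fin n → ℝ) := sInf S
  -- `I` is a minimal set of coordinates such that on `Y` every other one is `0` or, up to sign,
  -- equal to one of them; it turns out to be a system of coordinates on `Y`
  let P : Finset (Fin n) → Prop := fun I => ∀ i, ∃ (ε : ℝ) (j : Fin n),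
    (ε = 0 ∨ ε = 1 ∨ ε = -1) ∧ (ε = 0 ∨ j ∈ I) ∧ ∀ x ∈ Y, x i = ε * x j
  obtain ⟨I, hI⟩ := (Set.toFinite {I | P I}).exists_minimal
    ⟨Finset.univ, fun i => ⟨1, i, by simp⟩⟩
  have hmin : ∀ b ∈ I, ∀ (ε : ℝ) (c : Fin n), (ε = 0 ∨ ε = 1 ∨ ε = -1) →
      (ε = 0 ∨ c ∈ I ∧ c ≠ b) → ¬ ∀ x ∈ Y, x b = ε * x c := by
    intro b hb ε c hε hc hx
    have hP : P (I.erase b) := by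
      intro i
      obtain ⟨δ, j, hδ, hj, hij⟩ := hI.prop i
      by_cases hjb : j = b
      · subst hjb
        refine ⟨δ * ε, c, ?_, ?_, fun x hxY => by rw [hij x hxY, hx x hxY, mul_assoc]⟩
        · rcases hδ with rfl | rfl | rfl <;> rcases hε with rfl | rfl | rfl <;> simp
        · rcases hc with rfl | ⟨hc, hcb⟩
          · simp
          · exact Or.inr (Finset.mem_erase.2 ⟨hcb, hc⟩)
      · exact ⟨δ, j, hδ, hj.imp_right fun h => Finset.mem_erase.2 ⟨hjb, h⟩, hij⟩
    exact Finset.notMem_erase b I (hI.le_of_le hP (Finset.erase_subset b I) hb)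
  choose ε f hε hf hεf using hI.prop
  have hne0 : ∀ b ∈ I, ¬ ∀ x ∈ Y, x b = 0 := fun b hb h =>
    hmin b hb 0 b (Or.inl rfl) (Or.inl rfl) fun x hx => by rw [h x hx, zero_mul]
  have hfI : ∀ i ∈ I, f i = i ∧ ε i = 1 := by
    intro i hi
    have h : ¬(ε i = 0 ∨ f i ∈ I ∧ f i ≠ i) := fun hc => hmin i hi (ε i) (f i) (hε i) hc (hεf i)
    rw [not_or, not_and, not_not] at h
    have hfi : f i = i := h.2 ((hf i).resolve_left h.1)
    refine ⟨hfi, ((hε i).resolve_left h.1).resolve_right fun h1 => hne0 i hi fun x hx => ?_⟩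
    have := hεf i x hx
    rw [hfi, h1] at this
    linarith
  have hext : ∀ y : Fin n → ℝ, (fun i => ε i * y (f i)) ∈ Y := by
    intro y
    refine Submodule.mem_sInf.2 fun H hH => ?_
    obtain ⟨i, j, δ, hδ, hHδ⟩ := hS H hH
    rw [hHδ]
    have hrel : ∀ x ∈ Y, ε i * x (f i) = (δ * ε j) * x (f j) := by
      intro x hx
      rw [← hεf i x hx, mul_assoc, ← hεf j x hx]
      exact (hHδ x).1 (Submodule.mem_sInf.1 hx H hH)
    have hβ : δ * ε j = 0 ∨ δ * ε j = 1 ∨ δ * ε j = -1 := by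
      rcases hδ with rfl | rfl | rfl <;> rcases hε j with h | h | h <;> simp [h]
    have hβI : δ * ε j = 0 ∨ f j ∈ I := (hf j).imp_left fun h => by rw [h, mul_zero]
    have hα := hε i
    have hαI := hf i
    change ε i * y (f i) = δ * (ε j * y (f j))
    rw [← mul_assoc]
    generalize δ * ε j = β at *
    generalize ε i = α at *
    generalize f i = b at *
    generalize f j = c at *
    by_cases hα0 : α = 0
    · by_cases hβ0 : β = 0
      · rw [hα0, hβ0, zero_mul, zero_mul]
      · refine absurd (fun x hx => ?_) (hne0 c (hβI.resolve_left hβ0))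
        have := hrel x hx
        rw [hα0, zero_mul, zero_eq_mul] at this
        exact this.resolve_left hβ0
    · have hb := hαI.resolve_left hα0
      by_cases hβ0 : β = 0
      · refine absurd (fun x hx => ?_) (hne0 b hb)
        have := hrel x hx
        rw [hβ0, zero_mul, mul_eq_zero] at this
        exact this.resolve_left hα0
      · have hc := hβI.resolve_left hβ0
        have hα' := hα.resolve_left hα0
        have hβ' := hβ.resolve_left hβ0
        have hx : ∀ x ∈ Y, x b = (α * β) * x c := by
          intro x hx
          have := hrel x hx
          rcases hα' with rfl | rfl <;> linarith
        have hbc : c = b := by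
          by_contra hcb
          refine hmin b hb (α * β) c ?_ (Or.inr ⟨hc, hcb⟩) hx
          rcases hα' with rfl | rfl <;> rcases hβ' with rfl | rfl <;> simp
        subst hbc
        have hαβ : α = β := by
          by_contra hαβ
          refine hne0 c hc fun x hxY => ?_
          have h1 := hx x hxY
          have h2 : α * β = -1 := by
            rcases hα' with rfl | rfl <;> rcases hβ' with rfl | rfl <;> simp at hαβ ⊢
          rw [h2] at h1
          linarith
        rw [hαβ]
  let r : Y →ₗ[ℝ] (I → ℝ) := (LinearMap.funLeft ℝ ℝ (Subtype.val : I → Fin n)).comp Y.subtype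
  have hr : Function.Bijective r := by
    constructor
    · intro x y hxy
      refine Subtype.ext (funext fun i => ?_)
      rw [hεf i x x.2, hεf i y y.2]
      rcases hf i with h | h
      · rw [h, zero_mul, zero_mul]
      · exact congrArg (ε i * ·) (congrFun hxy ⟨f i, h⟩)
    · intro y
      refine ⟨⟨_, hext fun i => if h : i ∈ I then y ⟨i, h⟩ else 0⟩, funext fun i => ?_⟩
      change ε i * (if h : f i ∈ I then y ⟨f i, h⟩ else 0) = y i
      obtain ⟨h1, h2⟩ := hfI i i.2
      rw [h2, one_mul]
      simp [h1]
  have hrank : Module.finrank ℝ Y = I.card := by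
    rw [(LinearEquiv.ofBijective r hr).finrank_eq, Module.finrank_fintype_fun_eq_card,
      Fintype.card_coe]
  have hcard : (Fintype.piFinset fun _ : I => W).card = W.card ^ I.card := by
    simp [Fintype.card_piFinset]
  rw [hrank, ← hcard]
  refine Finset.card_bij (fun x _ i => x i) ?_ ?_ ?_
  · intro x hx
    rw [Finset.mem_filter, Fintype.mem_piFinset] at hx
    exact Fintype.mem_piFinset.2 fun i => hx.1 i
  · intro x hx y hy hxy
    rw [Finset.mem_filter] at hx hy
    exact congrArg Subtype.val (hr.1 (a₁ := ⟨x, hx.2⟩) (a₂ := ⟨y, hy.2⟩) hxy)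
  · intro y hy
    rw [Fintype.mem_piFinset] at hy
    obtain ⟨x, hx⟩ := hr.2 y
    have hxy : ∀ i : I, x.1 i = y i := fun i => congrFun hx i
    refine ⟨x, Finset.mem_filter.2 ⟨Fintype.mem_piFinset.2 fun i => ?_, x.2⟩, hx⟩
    rw [hεf i x x.2]
    rcases hf i with h | h
    · rwa [h, zero_mul]
    · have hmem : x.1 (f i) ∈ W := hxy ⟨f i, h⟩ ▸ hy ⟨f i, h⟩
      rcases hε i with h1 | h1 | h1 <;> rw [h1]
      · rwa [zero_mul]
      · rwa [one_mul]
      · rw [neg_one_mul]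
        exact hWneg _ hmem

open Classical in
theorem arrDB_charPoly_eval {n k : ℕ} {W : Finset ℝ} (hW0 : (0 : ℝ) ∈ W)
    (hWneg : ∀ w ∈ W, -w ∈ W) :
    (arrDB n k).charPoly.eval (W.card : ℤ) =
      ((Fintype.piFinset fun _ : Fin n => W).filter fun x =>
        Function.Injective (fun i => |x i|) ∧ ∀ i : Fin n, (i : ℕ) < k → x i ≠ 0).card := by
  rw [(arrDB n k).charPoly_eval_eq_card (Fintype.piFinset fun _ : Fin n => W) W.card]
  · congr 2
    refine Finset.filter_congr fun x _ => ?_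
    rw [← range_planeDB, Set.forall_mem_range]
    constructor
    · intro h
      have hlt : ∀ i j : Fin n, i < j → |x i| ≠ |x j| := fun i j hij habs => by
        rcases abs_eq_abs.1 habs with h1 | h1
        · exact h (.inr (⟨(i, j), hij⟩, true)) (mem_minusPlane.2 h1)
        · exact h (.inr (⟨(i, j), hij⟩, false)) (mem_plusPlane.2 h1)
      refine ⟨fun i j hij => ?_, fun i hi h0 => h (.inl ⟨i, hi⟩) (mem_coordPlane.2 h0)⟩
      by_contra hne
      rcases lt_or_gt_of_ne hne with h1 | h1
      · exact hlt i j h1 hij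
      · exact hlt j i h1 hij.symm
    · rintro ⟨hinj, h0⟩ (i | ⟨p, _ | _⟩) hx
      · exact h0 i.1 i.2 (mem_coordPlane.1 hx)
      · exact p.2.ne (hinj (abs_eq_abs.2 (Or.inr (mem_plusPlane.1 hx))))
      · exact p.2.ne (hinj (abs_eq_abs.2 (Or.inl (mem_minusPlane.1 hx))))
  · rintro ⟨X, S, hS, hXS⟩
    obtain rfl : X = OrderDual.toDual (sInf S) := hXS
    refine card_filter_mem_sInf (fun H hH => ?_) hW0 hWneg
    obtain ⟨a, rfl⟩ := (range_planeDB n k).symm ▸ hS hH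
    rcases a with i | ⟨p, _ | _⟩
    · exact ⟨i, i, 0, by simp, fun x => by simp [planeDB, mem_coordPlane]⟩
    · exact ⟨p.1.1, p.1.2, -1, by simp, fun x => by simp [planeDB, mem_plusPlane]⟩
    · exact ⟨p.1.1, p.1.2, 1, by simp, fun x => by simp [planeDB, mem_minusPlane]⟩

end HyperplaneArr

namespace HyperplaneArr

/-! ### Points whose coordinates have different absolute values -/

/-- The finite set of all `w` with `w = 0` or `|w| ∈ T`, for a set `T` of positive numbers. -/
noncomputable def symmSet (T : Finset ℝ) : Finset ℝ :=
  insert 0 (T ∪ T.image Neg.neg)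

theorem mem_symmSet {T : Finset ℝ} (hT : ∀ t ∈ T, 0 < t) {w : ℝ} :
    w ∈ symmSet T ↔ w = 0 ∨ |w| ∈ T := by
  simp only [symmSet, Finset.mem_insert, Finset.mem_union, Finset.mem_image]
  refine or_congr_right ⟨?_, fun h => ?_⟩
  · rintro (h | ⟨t, h, rfl⟩)
    · rwa [abs_of_pos (hT w h)]
    · rwa [abs_neg, abs_of_pos (hT t h)]
  · rcases abs_choice w with h1 | h1 <;> rw [h1] at h
    · exact Or.inl h
    · exact Or.inr ⟨_, h, neg_neg w⟩

theorem neg_mem_symmSet {T : Finset ℝ} (hT : ∀ t ∈ T, 0 < t) (w : ℝ) (hw : w ∈ symmSet T) :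
    -w ∈ symmSet T := by
  rw [mem_symmSet hT] at hw ⊢
  rwa [abs_neg, neg_eq_zero]

theorem card_symmSet {T : Finset ℝ} (hT : ∀ t ∈ T, 0 < t) :
    (symmSet T).card = 2 * T.card + 1 := by
  rw [symmSet, Finset.card_insert_of_notMem, Finset.card_union_of_disjoint,
    Finset.card_image_of_injective _ neg_injective, two_mul]
  · rw [Finset.disjoint_left]
    intro t ht h
    obtain ⟨s, hs, rfl⟩ := Finset.mem_image.1 h
    linarith [hT s hs, hT _ ht]
  · intro h
    rcases Finset.mem_union.1 h with h | h
    · exact lt_irrefl _ (hT 0 h)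
    · obtain ⟨s, hs, h0⟩ := Finset.mem_image.1 h
      linarith [hT s hs]

open Classical in
/-- A point with nonzero coordinates of different absolute values in `T` is the choice of the
absolute values, in order, and of the signs. -/
theorem card_injective_abs_of_ne_zero {ι : Type*} [Fintype ι] [DecidableEq ι] {T : Finset ℝ}
    (hT : ∀ t ∈ T, 0 < t) :
    ((Fintype.piFinset fun _ : ι => symmSet T).filter fun x =>
        Function.Injective (fun i => |x i|) ∧ ∀ i, x i ≠ 0).card =
      2 ^ Fintype.card ι * T.card.descFactorial (Fintype.card ι) := by
  have hcard : Fintype.card ((ι → Bool) × (ι ↪ T)) =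
      2 ^ Fintype.card ι * T.card.descFactorial (Fintype.card ι) := by
    rw [Fintype.card_prod, Fintype.card_embedding_eq, Fintype.card_fun, Fintype.card_bool,
      Fintype.card_coe]
  rw [← hcard, ← Finset.card_univ]
  symm
  have habs : ∀ (p : (ι → Bool) × (ι ↪ T)) (i : ι),
      |if p.1 i then (p.2 i : ℝ) else -(p.2 i : ℝ)| = p.2 i := by
    intro p i
    split_ifs
    · exact abs_of_pos (hT _ (p.2 i).2)
    · rw [abs_neg, abs_of_pos (hT _ (p.2 i).2)]
  refine Finset.card_bij (fun p _ i => if p.1 i then (p.2 i : ℝ) else -(p.2 i : ℝ)) ?_ ?_ ?_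
  · intro p _
    simp only [Finset.mem_filter, Fintype.mem_piFinset, mem_symmSet hT, habs]
    refine ⟨fun i => Or.inr (p.2 i).2, fun i j hij => p.2.injective (Subtype.ext hij), fun i => ?_⟩
    rw [← abs_pos, habs]
    exact hT _ (p.2 i).2
  · intro p _ q _ hpq
    have h2 : ∀ i, p.2 i = q.2 i := fun i => Subtype.ext <| by
      rw [← habs p, ← habs q]
      exact congrArg abs (congrFun hpq i)
    refine Prod.ext (funext fun i => ?_) (DFunLike.ext _ _ h2)
    have hi := congrFun hpq i
    have hpos := hT _ (q.2 i).2
    simp only [h2 i] at hi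
    rcases hp : p.1 i <;> rcases hq : q.1 i <;> simp only [hp, hq, if_true, if_false,
      Bool.false_eq_true] at hi <;> first | rfl | linarith
  · intro x hx
    simp only [Finset.mem_filter, Fintype.mem_piFinset, mem_symmSet hT] at hx
    obtain ⟨hxT, hinj, h0⟩ := hx
    let e : ι ↪ T := ⟨fun i => ⟨|x i|, (hxT i).resolve_left (h0 i)⟩,
      fun i j hij => hinj (congrArg Subtype.val hij)⟩
    have he : ∀ i, (e i : ℝ) = |x i| := fun _ => rfl
    refine ⟨(fun i => decide (0 < x i), e), Finset.mem_univ _, funext fun i => ?_⟩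
    rcases lt_or_gt_of_ne (h0 i) with h | h
    · rw [if_neg (by simpa using h.le), he, abs_of_neg h, neg_neg]
    · rw [if_pos (by simpa using h), he, abs_of_pos h]

open Classical in
theorem card_injective_abs_of_eq_zero {ι : Type*} [Fintype ι] [DecidableEq ι] {T : Finset ℝ}
    (hT : ∀ t ∈ T, 0 < t) (a : ι) :
    ((Fintype.piFinset fun _ : ι => symmSet T).filter fun x =>
        Function.Injective (fun i => |x i|) ∧ x a = 0).card =
      2 ^ (Fintype.card ι - 1) * T.card.descFactorial (Fintype.card ι - 1) := by
  have hcard : Fintype.card {i // i ≠ a} = Fintype.card ι - 1 := Set.card_ne_eq a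
  rw [← hcard, ← card_injective_abs_of_ne_zero hT]
  refine Finset.card_bij (fun x _ i => x i) ?_ ?_ ?_
  · intro x hx
    simp only [Finset.mem_filter, Fintype.mem_piFinset] at hx ⊢
    obtain ⟨hxT, hinj, h0⟩ := hx
    refine ⟨fun i => hxT i, hinj.comp Subtype.val_injective, fun i hi => i.2 (hinj ?_)⟩
    simp [hi, h0]
  · intro x hx y hy hxy
    simp only [Finset.mem_filter] at hx hy
    funext i
    by_cases hi : i = a
    · rw [hi, hx.2.2, hy.2.2]
    · exact congrFun hxy ⟨i, hi⟩
  · intro y hy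
    simp only [Finset.mem_filter, Fintype.mem_piFinset] at hy
    obtain ⟨hyT, hinj, h0⟩ := hy
    refine ⟨fun i => if h : i = a then 0 else y ⟨i, h⟩, ?_, funext fun i => dif_neg i.2⟩
    simp only [Finset.mem_filter, Fintype.mem_piFinset]
    refine ⟨fun i => ?_, fun i j hij => ?_, by simp⟩
    · split_ifs with h
      · exact (mem_symmSet hT).2 (Or.inl rfl)
      · exact hyT _
    · by_cases hi : i = a <;> by_cases hj : j = a <;> simp only [hi, hj, dif_pos, dif_neg,
        not_false_eq_true, abs_zero] at hij ⊢
      · exact absurd (abs_eq_zero.1 hij.symm) (h0 _)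
      · exact absurd (abs_eq_zero.1 hij) (h0 _)
      · exact congrArg Subtype.val (hinj hij)

open Classical in
/-- A point whose coordinates have different absolute values has at most one zero coordinate. -/
theorem card_injective_abs {ι : Type*} [Fintype ι] [DecidableEq ι] {T : Finset ℝ} (hT : ∀ t ∈ T, 0 < t)
    (p : ι → Prop) [DecidablePred p] :
    ((Fintype.piFinset fun _ : ι => symmSet T).filter fun x =>
        Function.Injective (fun i => |x i|) ∧ ∀ i, p i → x i ≠ 0).card =
      2 ^ Fintype.card ι * T.card.descFactorial (Fintype.card ι) +
        (Finset.univ.filter fun i => ¬ p i).card *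
          (2 ^ (Fintype.card ι - 1) * T.card.descFactorial (Fintype.card ι - 1)) := by
  have hdecomp : ((Fintype.piFinset fun _ : ι => symmSet T).filter fun x =>
        Function.Injective (fun i => |x i|) ∧ ∀ i, p i → x i ≠ 0) =
      ((Fintype.piFinset fun _ : ι => symmSet T).filter fun x =>
        Function.Injective (fun i => |x i|) ∧ ∀ i, x i ≠ 0) ∪
      (Finset.univ.filter fun i => ¬ p i).biUnion fun a =>
        (Fintype.piFinset fun _ : ι => symmSet T).filter fun x =>
          Function.Injective (fun i => |x i|) ∧ x a = 0 := by
    ext x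
    simp only [Finset.mem_union, Finset.mem_biUnion, Finset.mem_filter, Finset.mem_univ, true_and]
    constructor
    · rintro ⟨hx, hinj, h0⟩
      by_cases h : ∀ i, x i ≠ 0
      · exact Or.inl ⟨hx, hinj, h⟩
      · push Not at h
        obtain ⟨a, ha⟩ := h
        exact Or.inr ⟨a, fun hpa => h0 a hpa ha, hx, hinj, ha⟩
    · rintro (⟨hx, hinj, h0⟩ | ⟨a, hpa, hx, hinj, ha⟩)
      · exact ⟨hx, hinj, fun i _ => h0 i⟩
      · refine ⟨hx, hinj, fun i hpi hi => hpa ?_⟩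
        have : i = a := hinj (by simp [hi, ha])
        rwa [← this]
  rw [hdecomp, Finset.card_union_of_disjoint, Finset.card_biUnion, card_injective_abs_of_ne_zero hT,
    Finset.sum_congr rfl fun a _ => card_injective_abs_of_eq_zero hT a, Finset.sum_const,
    smul_eq_mul]
  · intro a _ b _ hab
    refine Finset.disjoint_left.2 fun x hx hx' => hab ?_
    simp only [Finset.mem_filter] at hx hx'
    exact hx.2.1 (by simp [hx.2.2, hx'.2.2])
  · refine Finset.disjoint_left.2 fun x hx hx' => ?_
    simp only [Finset.mem_biUnion, Finset.mem_filter] at hx hx'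
    obtain ⟨a, -, -, -, ha⟩ := hx'
    exact hx.2.2 a ha

theorem descFactorial_cast_mul_two_pow {m r : ℕ} (h : r ≤ m) :
    ((2 ^ r * m.descFactorial r : ℕ) : ℤ) =
      ∏ j ∈ Finset.range r, ((2 * m + 1 : ℤ) - (2 * j + 1)) := by
  induction r with
  | zero => simp
  | succ r ih =>
    rw [Finset.prod_range_succ, ← ih (by omega), Nat.descFactorial_succ]
    push_cast [Nat.cast_sub (show r ≤ m by omega)]
    ring

/-- The two polynomials agree at `2m + 1` for all `m ≥ r + 1`, by counting the points off the
arrangement with coordinates in a symmetric set of `2m + 1` numbers. -/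
theorem arrDB_charPoly {r k : ℕ} (hk : k ≤ r + 1) :
    (arrDB (r + 1) k).charPoly =
      (∏ j ∈ Finset.range r, (Polynomial.X - Polynomial.C (2 * j + 1 : ℤ))) *
        (Polynomial.X - Polynomial.C (r + k : ℤ)) := by
  classical
  refine Polynomial.eq_of_infinite_eval_eq _ _ (Set.Infinite.mono (s :=
    (fun m : ℕ => (2 * m + 1 : ℤ)) '' Set.Ici (r + 1)) ?_ ?_)
  · rintro _ ⟨m, hm, rfl⟩
    simp only [Set.mem_Ici] at hm
    let T : Finset ℝ := (Finset.Icc 1 m).map Nat.castEmbedding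
    have hT : ∀ t ∈ T, 0 < t := by
      intro t ht
      obtain ⟨a, ha, rfl⟩ := Finset.mem_map.1 ht
      exact Nat.cast_pos.2 (Finset.mem_Icc.1 ha).1
    have hTm : T.card = m := by simp [T]
    have hcount := card_injective_abs hT fun i : Fin (r + 1) => (i : ℕ) < k
    have heval := arrDB_charPoly_eval (n := r + 1) (k := k) (W := symmSet T)
      ((mem_symmSet hT).2 (Or.inl rfl)) (neg_mem_symmSet hT)
    have hfilter : (Finset.univ.filter fun i : Fin (r + 1) => ¬ (i : ℕ) < k).card = r + 1 - k := by
      have h1 := Finset.card_filter_add_card_filter_not (s := (Finset.univ : Finset (Fin (r + 1))))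
        (fun i => (i : ℕ) < k)
      rw [Fin.card_filter_val_lt, min_eq_right hk, Finset.card_univ, Fintype.card_fin] at h1
      omega
    rw [hTm, hfilter, Fintype.card_fin, Nat.add_sub_cancel] at hcount
    have heval' : (arrDB (r + 1) k).charPoly.eval ((2 * m + 1 : ℕ) : ℤ) =
        ((2 ^ (r + 1) * m.descFactorial (r + 1) +
          (r + 1 - k) * (2 ^ r * m.descFactorial r) : ℕ) : ℤ) := by
      rw [← hcount, ← hTm, ← card_symmSet hT, heval]
      congr!
    simp only [Set.mem_ofPred_eq]
    push_cast at heval'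
    rw [heval']
    have h1 := descFactorial_cast_mul_two_pow (m := m) (r := r) (by omega)
    push_cast at h1
    have hsub : ((r + 1 - k : ℕ) : ℤ) = r + 1 - k := by
      rw [Nat.cast_sub hk]
      push_cast
      ring
    have hmr : ((m - r : ℕ) : ℤ) = m - r := Nat.cast_sub (by omega)
    simp only [Polynomial.eval_mul, Polynomial.eval_prod, Polynomial.eval_sub, Polynomial.eval_X,
      Polynomial.eval_C]
    rw [← h1, hsub, Nat.descFactorial_succ, Nat.cast_mul, hmr]
    ring
  · refine (Set.Ici_infinite (r + 1)).image fun a _ b _ hab => ?_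
    have : (2 * a + 1 : ℤ) = 2 * b + 1 := hab
    omega

theorem arrDB_exponents {n k : ℕ} (hn : 1 ≤ n) (hk : k ≤ n) :
    (arrDB n k).exponents =
      (Multiset.range (n - 1)).map (fun j => ((2 * j + 1 : ℕ) : ℂ)) + {((n - 1 + k : ℕ) : ℂ)} := by
  obtain ⟨r, rfl⟩ : ∃ r, n = r + 1 := ⟨n - 1, by omega⟩
  have hmap : (arrDB (r + 1) k).charPoly.map (algebraMap ℤ ℂ) =
      (((Multiset.range r).map (fun j => ((2 * j + 1 : ℕ) : ℂ)) + {((r + k : ℕ) : ℂ)}).map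
        fun a => Polynomial.X - Polynomial.C a).prod := by
    rw [arrDB_charPoly hk, Polynomial.map_mul, Polynomial.map_prod, Multiset.map_add,
      Multiset.prod_add, Multiset.map_map, Multiset.map_singleton, Multiset.prod_singleton]
    congr 1
    · rw [Finset.prod, Finset.range_val]
      congr 1
      refine Multiset.map_congr rfl fun j _ => ?_
      rw [Function.comp_apply, Polynomial.map_sub, Polynomial.map_X, Polynomial.map_C]
      simp only [map_add, map_mul, map_natCast, map_one, map_ofNat, Nat.cast_add, Nat.cast_mul,
        Nat.cast_one, Nat.cast_ofNat]
    · simp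
  rw [Arrangement.exponents, Polynomial.aroots, hmap, Polynomial.roots_multiset_prod_X_sub_C,
    Nat.add_sub_cancel]

end HyperplaneArr
theorem mainTheorem5 (n k : ℕ) (hn : 1 ≤ n) (hk : k ≤ n) :
    -- interpolation between the types D and B
    HyperplaneArr.arrDB n 0 = HyperplaneArr.weylD n ∧
    HyperplaneArr.arrDB n n = HyperplaneArr.weylB n ∧
    -- freeness, with the given sequence as a basis
    (HyperplaneArr.arrDB n k).IsFree ∧
    (∃ b : Module.Basis (Fin n) (HyperplaneArr.Poly n) (HyperplaneArr.arrDB n k).derivations,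
      ∀ j, (b j : HyperplaneArr.Der n) = HyperplaneArr.basisDB n k j) ∧
    -- the determinant is, up to the sign of the ordering, the defining polynomial
    (HyperplaneArr.coeffMatrix (HyperplaneArr.basisDB n k)).det =
      (-1) ^ ((n - 1) * (n + 2) / 2) * HyperplaneArr.polyDB n k ∧
    (HyperplaneArr.arrDB n k).IsDefiningPolynomial (HyperplaneArr.polyDB n k) ∧
    -- the exponents: degrees of the basis plus one, and roots of the characteristic polynomial
    (∀ j, HyperplaneArr.HasDegree (HyperplaneArr.basisDB n k j)
      ((HyperplaneArr.exponentDB n k j : ℤ) - 1)) ∧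
    (HyperplaneArr.arrDB n k).exponents =
      (Multiset.range (n - 1)).map (fun j => ((2 * j + 1 : ℕ) : ℂ)) +
        {((n - 1 + k : ℕ) : ℂ)} := by
  have hbasis := HyperplaneArr.exists_basis_basisDB (k := k) hn
  refine ⟨HyperplaneArr.arrDB_zero n, HyperplaneArr.arrDB_self n, ?_, hbasis,
    HyperplaneArr.det_coeffMatrix_basisDB hn, HyperplaneArr.isDefiningPolynomial_polyDB n k,
    HyperplaneArr.hasDegree_basisDB hk, HyperplaneArr.arrDB_exponents hn hk⟩
  obtain ⟨b, -⟩ := hbasis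
  exact Module.Free.of_basis b
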